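/- Let $a,b>0$ and let $L^2(\mathbb R)$ be the space of complex-valued square-integrable functions on $\mathbb R$ modulo almost-everywhere equality. Put $$\mathcal B_{a,b}:=\{f\in L^2(\mathbb R): \|f\|_{L^\infty(\mathbb R)}<a \text{ and } \operatorname{supp}(f)\subseteq[0,b]\}.$$ For $c\in\mathbb R$ let $L^2_c(\mathbb R):=\{f+c: f\in L^2(\mathbb R)\}$, endowed with the metric $d_{L^2_c(\mathbb R)}(f,g):=\|f-g\|_{L^2(\mathbb R)}$. Let $\hat f$ denote the Fourier transform of $f\in L^2(\mathbb R)$, i.e. the continuous extension to $L^2(\mathbb R)$ of $\hat f(\xi)=\int_{\mathbb R} f(x)e^{-2\pi i\xi x}\,dx$. Suppose $c>ab$. Then $\mathcal A: f\mapsto|\hat f+c|$ is an injective mapping from $\mathcal B_{a,b}$ to $L^2_c(\mathbb R)$, and its inverse $\mathcal A^{-1}:\mathcal A(\mathcal B_{a,b})\subseteq L^2_c(\mathbb R)\to\mathcal B_{a,b}$ (where $\mathcal B_{a,b}$ carries the $L^2$ metric) is uniformly continuous; indeed it is Lipschitz: there exists a constant $C>0$ (which may depend on $a,b,c$) such that $$\|f_1-f_2\|_{L^2(\mathbb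 R)}\le C\, d_{L^2_c(\mathbb R)}\bigl(|\hat f_1+c|,|\hat f_2+c|\bigr)\qquad\text{for all } f_1,f_2\in\mathcal B_{a,b}.$$ -/

import Mathlib

open MeasureTheory Set
open scoped FourierTransform ENNReal

noncomputable section

/-- The complex Hilbert space `L²(ℝ)` (with respect to Lebesgue measure). -/
abbrev L2R : Type := Lp ℂ 2 (volume : Measure ℝ)

/-- The set `𝓑_{a,b}` of all `f ∈ L²(ℝ)` with `‖f‖_{L^∞} < a` and `supp f ⊆ [0,b]`. The support of
an almost-everywhere class lies in the closed set `[0,b]` iff the class vanishes a.e. off it. -/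
def BoundedSupported (a b : ℝ) : Set L2R :=
  {f | eLpNorm f ∞ volume < ENNReal.ofReal a ∧
    ∀ᵐ t ∂(volume : Measure ℝ), t ∉ Icc 0 b → f t = 0}

/-- The set `L²_c(ℝ) = {f + c : f ∈ L²(ℝ)}` of classes of measurable functions modulo
almost-everywhere equality. -/
def L2Shift (c : ℝ) : Set (ℝ →ₘ[(volume : Measure ℝ)] ℂ) :=
  {g | ∃ f : L2R, g = (f : ℝ →ₘ[(volume : Measure ℝ)] ℂ) + AEEqFun.const ℝ (c : ℂ)}

/-- Differences of elements of `L²_c(ℝ)` belong to `L²(ℝ)`. -/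
theorem L2Shift.sub_mem {c : ℝ} (f g : L2Shift c) :
    f.1 - g.1 ∈ Lp ℂ 2 (volume : Measure ℝ) := by
  obtain ⟨_, u, rfl⟩ := f
  obtain ⟨_, v, rfl⟩ := g
  simpa using (u - v).2

/-- The metric `d(f, g) = ‖f - g‖_{L²(ℝ)}` on `L²_c(ℝ)`. -/
instance L2Shift.instMetricSpace (c : ℝ) : MetricSpace (L2Shift c) where
  dist f g := ‖(⟨f.1 - g.1, L2Shift.sub_mem f g⟩ : L2R)‖
  dist_self f := by
    rw [norm_eq_zero]
    exact Subtype.ext (sub_self f.1)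
  dist_comm f g := by
    rw [← norm_neg]
    congr 1
    exact Subtype.ext (neg_sub f.1 g.1)
  dist_triangle f g h := by
    refine le_trans (le_of_eq ?_) (norm_add_le _ _)
    congr 1
    exact Subtype.ext (sub_add_sub_cancel f.1 g.1 h.1).symm
  eq_of_dist_eq_zero {f g} h := by
    rw [norm_eq_zero] at h
    exact Subtype.ext (sub_eq_zero.mp (congrArg Subtype.val h))

/-- The measurement map `f ↦ |f̂ + c|`, where `f̂` is the Fourier transform on `L²(ℝ)` (the
continuous extension of `f̂(ξ) = ∫ f(x) e^{-2πi x ξ} dx`). -/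
def shiftedMagnitude (c : ℝ) (f : L2R) : ℝ →ₘ[(volume : Measure ℝ)] ℂ :=
  AEEqFun.comp (fun z : ℂ => ((‖z‖ : ℝ) : ℂ)) (Complex.continuous_ofReal.comp continuous_norm)
    (((𝓕 f : L2R) : ℝ →ₘ[(volume : Measure ℝ)] ℂ) + AEEqFun.const ℝ (c : ℂ))

end

/-! Write `f̂ = c u`. Since `f` is bounded by `a` and lives on `[0,b]`, `|u| ≤ q = ab/c < 1`, and
`u` is the transform of a function vanishing on the negative half-line. Products of such transforms
are again such transforms, and the integral over the line of a product of two of them is zero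
(`IsCausalTransform.integral_mul_eq_zero`). Approximating by Taylor sums, `h = log (1 + u) - log (1
+ v)` satisfies `∫ h² = 0`. Taking real parts, `Re h` and `Im h` have equal `L²` norms, so `‖h‖² = 2
‖Re h‖²`: the moduli control the lost phases. Finally `Re h = log |1 + u| - log |1 + v|` is bounded
by the difference of the moduli over `1 - q`, and `|u - v| ≤ (1 + q) |h|`. Plancherel then gives the
Lipschitz constant `√2 (1 + q) / (1 - q)`. -/

/-! ### The `L²` transform as a Fourier integral -/

/-- The `L²` Fourier transform of an integrable function is given by the Fourier integral. -/
theorem MeasureTheory.Lp.fourier_ae_eq_of_integrable {f : L2R} {g : ℝ → ℂ} (hfg : f =ᵐ[volume] g)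
    (hg : Integrable g) : (𝓕 f : L2R) =ᵐ[volume] 𝓕 g := by
  have hcont : Continuous (𝓕 g) :=
    VectorFourier.fourierIntegral_continuous Real.continuous_fourierChar
      (by exact continuous_inner) hg
  refine ae_eq_of_integral_contDiff_smul_eq
    ((Lp.memLp (𝓕 f)).locallyIntegrable (by norm_num)) hcont.locallyIntegrable fun φ hφ hsupp => ?_
  let ψ : SchwartzMap ℝ ℂ :=
    (hsupp.comp_left (g := Complex.ofReal) Complex.ofReal_zero).toSchwartzMap
      (Complex.ofRealCLM.contDiff.comp hφ)
  have hψ : ∀ x, ψ x = (φ x : ℂ) := fun x => rfl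
  -- Both transforms are tested against `ψ`: duality moves the transform onto `ψ`, where `f` may be
  -- replaced by `g`, and Fubini moves it back onto `g`.
  have h1 := congrArg (fun T => T ψ) (Lp.fourier_toTemperedDistribution_eq f)
  simp only [TemperedDistribution.fourier_apply, Lp.toTemperedDistribution_apply] at h1
  have h2 : ∫ x, (𝓕 ψ) x • f x = ∫ x, (𝓕 (ψ : ℝ → ℂ)) x • g x := by
    refine integral_congr_ae ?_
    filter_upwards [hfg] with x hx
    rw [hx, SchwartzMap.fourier_coe]
  have h3 : ∫ x, (𝓕 (ψ : ℝ → ℂ)) x • g x = ∫ x, ψ x • (𝓕 g) x := by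
    simpa using! (VectorFourier.integral_fourierIntegral_smul_eq_flip (L := innerₗ ℝ)
      Real.continuous_fourierChar continuous_inner ψ.integrable hg)
  simpa [hψ] using h1.symm.trans (h2.trans h3)

/-! ### Causal functions and their transforms -/

/-- Bounded integrable functions vanishing on the negative half-line. -/
structure IsCausal (f : ℝ → ℂ) : Prop where
  integrable : Integrable f
  bounded : ∃ M, ∀ x, ‖f x‖ ≤ M
  eq_zero_of_neg : ∀ x < 0, f x = 0

namespace IsCausal

variable {f g : ℝ → ℂ}

theorem memLp_two (hf : IsCausal f) : MemLp f 2 := by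
  obtain ⟨M, hM⟩ := hf.bounded
  rw [memLp_two_iff_integrable_sq_norm hf.integrable.aestronglyMeasurable]
  simp only [sq]
  exact hf.integrable.norm.bdd_mul hf.integrable.aestronglyMeasurable.norm
    (Filter.Eventually.of_forall fun x => by simpa using hM x)

theorem sub (hf : IsCausal f) (hg : IsCausal g) : IsCausal (f - g) := by
  obtain ⟨M, hM⟩ := hf.bounded
  obtain ⟨N, hN⟩ := hg.bounded
  refine ⟨hf.integrable.sub hg.integrable, ⟨M + N, fun x => ?_⟩, fun x hx => ?_⟩
  · exact (norm_sub_le _ _).trans (add_le_add (hM x) (hN x))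
  · simp [hf.eq_zero_of_neg x hx, hg.eq_zero_of_neg x hx]

theorem const_smul (hf : IsCausal f) (c : ℂ) : IsCausal (c • f) := by
  obtain ⟨M, hM⟩ := hf.bounded
  refine ⟨hf.integrable.smul c, ⟨‖c‖ * M, fun x => ?_⟩, fun x hx => ?_⟩
  · simpa using mul_le_mul_of_nonneg_left (hM x) (norm_nonneg c)
  · simp [hf.eq_zero_of_neg x hx]

-- For `x < 0`, either `t < 0` or `x - t < 0`, so the integrand vanishes.
open scoped Convolution in
theorem convolution (hf : IsCausal f) (hg : IsCausal g) :
    IsCausal (f ⋆[ContinuousLinearMap.mul ℂ ℂ] g) := by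
  obtain ⟨M, hM⟩ := hg.bounded
  refine ⟨hf.integrable.integrable_convolution _ hg.integrable, ⟨(∫ t, ‖f t‖) * M,
    fun x => ?_⟩, fun x hx => ?_⟩
  · rw [convolution_def, ← integral_mul_const]
    refine norm_integral_le_of_norm_le (hf.integrable.norm.mul_const M)
      (Filter.Eventually.of_forall fun t => ?_)
    simpa using mul_le_mul_of_nonneg_left (hM (x - t)) (norm_nonneg (f t))
  · rw [convolution_def]
    refine integral_eq_zero_of_ae (Filter.Eventually.of_forall fun t => ?_)
    rcases lt_or_ge t 0 with ht | ht
    · simp [hf.eq_zero_of_neg t ht]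
    · simp [hg.eq_zero_of_neg (x - t) (by linarith)]

end IsCausal

theorem Real.fourier_conj_comp_neg (f : ℝ → ℂ) (ξ : ℝ) :
    𝓕 (fun x => starRingEnd ℂ (f (-x))) ξ = starRingEnd ℂ (𝓕 f ξ) := by
  rw [Real.fourier_real_eq_integral_exp_smul, Real.fourier_real_eq_integral_exp_smul,
    ← integral_conj, ← integral_neg_eq_self]
  refine integral_congr_ae (Filter.Eventually.of_forall fun x => ?_)
  simp [← Complex.exp_conj, Complex.conj_ofNat]

/-- Fourier transforms of bounded integrable functions vanishing on the negative half-line. -/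
def IsCausalTransform (u : ℝ → ℂ) : Prop := ∃ f, IsCausal f ∧ u = 𝓕 f

namespace IsCausalTransform

variable {u v : ℝ → ℂ}

theorem memLp_two (hu : IsCausalTransform u) : MemLp u 2 := by
  obtain ⟨f, hf, rfl⟩ := hu
  exact (memLp_congr_ae (Lp.fourier_ae_eq_of_integrable hf.memLp_two.coeFn_toLp hf.integrable)).1
    (Lp.memLp _)

theorem continuous (hu : IsCausalTransform u) : Continuous u := by
  obtain ⟨f, hf, rfl⟩ := hu
  exact VectorFourier.fourierIntegral_continuous Real.continuous_fourierChar
    (by exact continuous_inner) hf.integrable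

theorem sub (hu : IsCausalTransform u) (hv : IsCausalTransform v) : IsCausalTransform (u - v) := by
  obtain ⟨f, hf, rfl⟩ := hu
  obtain ⟨g, hg, rfl⟩ := hv
  refine ⟨f - g, hf.sub hg, funext fun ξ => ?_⟩
  simp only [Real.fourier_eq, Pi.sub_apply, smul_sub]
  exact (integral_sub ((Real.fourierIntegral_convergent_iff ξ).2 hf.integrable)
    ((Real.fourierIntegral_convergent_iff ξ).2 hg.integrable)).symm

theorem const_smul (hu : IsCausalTransform u) (c : ℂ) : IsCausalTransform (c • u) := by
  obtain ⟨f, hf, rfl⟩ := hu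
  refine ⟨c • f, hf.const_smul c, funext fun ξ => ?_⟩
  simp only [Real.fourier_eq, Pi.smul_apply]
  rw [← integral_smul]
  simp only [smul_comm c]

theorem mul (hu : IsCausalTransform u) (hv : IsCausalTransform v) : IsCausalTransform (u * v) := by
  obtain ⟨f, hf, rfl⟩ := hu
  obtain ⟨g, hg, rfl⟩ := hv
  exact ⟨_, hf.convolution hg,
    funext fun ξ => (Real.fourier_mul_convolution_eq hf.integrable hg.integrable ξ).symm⟩

/-- Exponents start at 1 because the constant 1 is not in `L²`; the series of `log (1 + z)` has no
constant term. -/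
theorem pow_succ (hu : IsCausalTransform u) (n : ℕ) : IsCausalTransform (u ^ (n + 1)) := by
  induction n with
  | zero => simpa using hu
  | succ n ih => rw [_root_.pow_succ]; exact ih.mul hu

theorem zero : IsCausalTransform 0 :=
  ⟨0, ⟨integrable_zero _ _ _, ⟨0, by simp⟩, by simp⟩, by ext ξ; simp [Real.fourier_eq]⟩

/-- By Plancherel this is the inner product of `x ↦ conj (f (-x))` with `g`, whose supports lie in
opposite half-lines. -/
theorem integral_mul_eq_zero (hu : IsCausalTransform u) (hv : IsCausalTransform v) :
    ∫ ξ, u ξ * v ξ = 0 := by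
  obtain ⟨f, hf, rfl⟩ := hu
  obtain ⟨g, hg, rfl⟩ := hv
  set f' : ℝ → ℂ := fun x => starRingEnd ℂ (f (-x)) with hf'
  have hint : Integrable f' := by
    exact Complex.conjCLE.toContinuousLinearMap.integrable_comp hf.integrable.comp_neg
  have hmem : MemLp f' 2 := by
    simpa using! ((hf.memLp_two.comp_measurePreserving (Measure.measurePreserving_neg volume))).star
  have h := Lp.inner_fourier_eq hmem.toLp hg.memLp_two.toLp
  rw [L2.inner_def, L2.inner_def] at h
  calc ∫ ξ, 𝓕 f ξ * 𝓕 g ξ = _ := integral_congr_ae ?_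
    _ = _ := h
    _ = 0 := integral_eq_zero_of_ae ?_
  · filter_upwards [Lp.fourier_ae_eq_of_integrable hmem.coeFn_toLp hint,
      Lp.fourier_ae_eq_of_integrable hg.memLp_two.coeFn_toLp hg.integrable] with ξ h1 h2
    rw [h1, h2, hf', Real.fourier_conj_comp_neg]
    simp [mul_comm]
  -- The supports may meet at `0`, a null set.
  · filter_upwards [hmem.coeFn_toLp, hg.memLp_two.coeFn_toLp, Measure.ae_ne volume 0]
      with x h1 h2 hx
    rw [h1, h2]
    rcases lt_or_gt_of_ne hx with hx | hx
    · simp [hg.eq_zero_of_neg x hx]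
    · simp [hf', hf.eq_zero_of_neg (-x) (by linarith)]

end IsCausalTransform

/-! ### Estimates for the complex logarithm near 1 -/

/-- The partial sums of the Taylor series of `log (1 + z)`. -/
noncomputable def logPartialSum (N : ℕ) (z : ℂ) : ℂ :=
  -∑ n ∈ Finset.range N, (-z) ^ (n + 1) / (n + 1)

theorem tendsto_logPartialSum {z : ℂ} (hz : ‖z‖ < 1) :
    Filter.Tendsto (fun N => logPartialSum N z) Filter.atTop (nhds (Complex.log (1 + z))) := by
  have h := (Complex.hasSum_taylorSeries_neg_log' (z := -z) (by simpa)).tendsto_sum_nat.neg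
  simpa [logPartialSum] using h

/-- Uniformity in `N`, with a bound linear in `‖z‖`, supplies the dominating function for the limit
of the squares. -/
theorem norm_logPartialSum_le {q : ℝ} (hq : q < 1) {z : ℂ} (hz : ‖z‖ ≤ q) (N : ℕ) :
    ‖logPartialSum N z‖ ≤ ‖z‖ / (1 - q) := by
  have hq0 : 0 ≤ q := (norm_nonneg z).trans hz
  rw [logPartialSum, norm_neg]
  calc _ ≤ ∑ n ∈ Finset.range N, ‖z‖ * q ^ n := by
        refine norm_sum_le_of_le _ fun n _ => ?_
        rw [norm_div, norm_pow, norm_neg, pow_succ, mul_comm]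
        have h1 : ‖((n : ℂ) + 1)‖ = n + 1 := by exact_mod_cast Complex.norm_natCast (n + 1)
        rw [h1]
        exact (div_le_self (by positivity) (by linarith [Nat.cast_nonneg (α := ℝ) n])).trans
          (by gcongr)
    _ = ‖z‖ * ∑ n ∈ Finset.range N, q ^ n := by rw [Finset.mul_sum]
    _ ≤ ‖z‖ * (1 - q)⁻¹ := by
        gcongr
        rw [← tsum_geometric_of_lt_one hq0 hq]
        exact (summable_geometric_of_lt_one hq0 hq).sum_le_tsum _ fun n _ => by positivity
    _ = _ := (div_eq_mul_inv _ _).symm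

theorem norm_log_one_add_le {q : ℝ} (hq : q < 1) {z : ℂ} (hz : ‖z‖ ≤ q) :
    ‖Complex.log (1 + z)‖ ≤ ‖z‖ / (1 - q) :=
  le_of_tendsto (tendsto_logPartialSum (hz.trans_lt hq)).norm
    (Filter.Eventually.of_forall fun N => norm_logPartialSum_le hq hz N)

theorem one_add_ne_zero_of_norm_lt_one {z : ℂ} (hz : ‖z‖ < 1) : 1 + z ≠ 0 := by
  intro h
  rw [eq_neg_of_add_eq_zero_right h] at hz
  simp at hz

/-- Mean value inequality for `exp` on the convex half-plane `Re ≤ log (1 + q)`, where `|exp'| ≤ 1 +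
q`. -/
theorem norm_sub_le_mul_norm_log_sub_log {q : ℝ} (hq : q < 1) {z w : ℂ} (hz : ‖z‖ ≤ q)
    (hw : ‖w‖ ≤ q) :
    ‖z - w‖ ≤ (1 + q) * ‖Complex.log (1 + z) - Complex.log (1 + w)‖ := by
  have hmem : ∀ {z : ℂ}, ‖z‖ ≤ q → Complex.log (1 + z) ∈ {x : ℂ | x.re ≤ Real.log (1 + q)} := by
    intro z hz
    have h0 := norm_pos_iff.2 (one_add_ne_zero_of_norm_lt_one (hz.trans_lt hq))
    rw [mem_ofPred_eq, Complex.log_re]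
    exact Real.log_le_log h0 ((norm_add_le _ _).trans (by simpa using hz))
  have hq0 : 0 ≤ q := (norm_nonneg z).trans hz
  have h := (convex_halfSpace_re_le (Real.log (1 + q))).norm_image_sub_le_of_norm_deriv_le
    (f := Complex.exp) (C := 1 + q)
    (fun x _ => Complex.differentiableAt_exp) (fun x hx => by
      rw [Complex.deriv_exp, Complex.norm_exp, ← Real.le_log_iff_exp_le (by linarith)]
      exact hx) (hmem hw) (hmem hz)
  rw [Complex.exp_log (one_add_ne_zero_of_norm_lt_one (hz.trans_lt hq)),
    Complex.exp_log (one_add_ne_zero_of_norm_lt_one (hw.trans_lt hq))] at h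
  simpa using h

theorem abs_log_sub_log_le {m x y : ℝ} (hm : 0 < m) (hx : m ≤ x) (hy : m ≤ y) :
    |Real.log x - Real.log y| ≤ |x - y| / m := by
  have key : ∀ {x y : ℝ}, m ≤ x → m ≤ y → Real.log x - Real.log y ≤ |x - y| / m := by
    intro x y hx hy
    have hx0 := hm.trans_le hx
    have hy0 := hm.trans_le hy
    rw [← Real.log_div hx0.ne' hy0.ne']
    calc Real.log (x / y) ≤ x / y - 1 := Real.log_le_sub_one_of_pos (by positivity)
      _ = (x - y) / y := by field_simp
      _ ≤ |x - y| / y := by gcongr; exact le_abs_self _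
      _ ≤ |x - y| / m := by gcongr
  refine abs_le.2 ⟨?_, key hx hy⟩
  have := key hy hx
  rw [abs_sub_comm] at this
  linarith

theorem abs_re_log_sub_log_le {q : ℝ} (hq : q < 1) {z w : ℂ} (hz : ‖z‖ ≤ q) (hw : ‖w‖ ≤ q) :
    |(Complex.log (1 + z) - Complex.log (1 + w)).re| ≤ |‖1 + z‖ - ‖1 + w‖| / (1 - q) := by
  rw [Complex.sub_re, Complex.log_re, Complex.log_re]
  have h : ∀ {z : ℂ}, ‖z‖ ≤ q → 1 - q ≤ ‖1 + z‖ := fun {z} hz => by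
    have := norm_sub_le (1 + z) z
    simp only [add_sub_cancel_right, norm_one] at this
    linarith
  exact abs_log_sub_log_le (by linarith) (h hz) (h hw)

/-! ### Recovering the phase from the modulus -/

namespace IsCausalTransform

variable {u v : ℝ → ℂ}

theorem logPartialSum (hu : IsCausalTransform u) (N : ℕ) :
    IsCausalTransform fun ξ => logPartialSum N (u ξ) := by
  induction N with
  | zero => simpa [_root_.logPartialSum] using! zero
  | succ N ih =>
    have h := ih.sub ((hu.pow_succ N).const_smul ((-1) ^ (N + 1) / (N + 1)))
    convert h using 1
    ext ξ
    simp only [_root_.logPartialSum, Finset.sum_range_succ, Pi.sub_apply, Pi.smul_apply,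
      Pi.pow_apply, smul_eq_mul]
    rw [neg_pow (u ξ) (N + 1)]
    ring

theorem continuous_log (hu : IsCausalTransform u) {q : ℝ} (hq : q < 1) (huq : ∀ ξ, ‖u ξ‖ ≤ q) :
    Continuous fun ξ => Complex.log (1 + u ξ) := by
  refine (continuous_const.add hu.continuous).clog fun ξ => ?_
  exact Complex.mem_slitPlane_of_norm_lt_one ((huq ξ).trans_lt hq)

theorem memLp_log (hu : IsCausalTransform u) {q : ℝ} (hq : q < 1) (huq : ∀ ξ, ‖u ξ‖ ≤ q) :
    MemLp (fun ξ => Complex.log (1 + u ξ)) 2 := by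
  refine hu.memLp_two.of_le_mul (c := (1 - q)⁻¹)
    (hu.continuous_log hq huq).aestronglyMeasurable (Filter.Eventually.of_forall fun ξ => ?_)
  rw [mul_comm, ← div_eq_mul_inv]
  exact norm_log_one_add_le hq (huq ξ)

theorem integral_log_sub_log_sq_eq_zero (hu : IsCausalTransform u) (hv : IsCausalTransform v)
    {q : ℝ} (hq : q < 1) (huq : ∀ ξ, ‖u ξ‖ ≤ q) (hvq : ∀ ξ, ‖v ξ‖ ≤ q) :
    ∫ ξ, (Complex.log (1 + u ξ) - Complex.log (1 + v ξ)) ^ 2 = 0 := by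
  have hS N := (hu.logPartialSum N).sub (hv.logPartialSum N)
  have hlim : Filter.Tendsto
      (fun N => ∫ ξ, (_root_.logPartialSum N (u ξ) - _root_.logPartialSum N (v ξ)) ^ 2)
      Filter.atTop (nhds (∫ ξ, (Complex.log (1 + u ξ) - Complex.log (1 + v ξ)) ^ 2)) := by
    refine tendsto_integral_of_dominated_convergence
      (fun ξ => (‖u ξ‖ / (1 - q) + ‖v ξ‖ / (1 - q)) ^ 2)
      (fun N => ((hS N).continuous.pow 2).aestronglyMeasurable) ?_ (fun N => ?_) ?_
    · simp only [div_eq_mul_inv]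
      exact ((hu.memLp_two.norm.mul_const _).add (hv.memLp_two.norm.mul_const _)).integrable_sq
    · refine Filter.Eventually.of_forall fun ξ => ?_
      rw [norm_pow]
      gcongr
      exact (norm_sub_le _ _).trans (add_le_add (norm_logPartialSum_le hq (huq ξ) N)
        (norm_logPartialSum_le hq (hvq ξ) N))
    · exact Filter.Eventually.of_forall fun ξ =>
        ((tendsto_logPartialSum ((huq ξ).trans_lt hq)).sub
          (tendsto_logPartialSum ((hvq ξ).trans_lt hq))).pow 2
  have hzero : ∀ N, ∫ ξ, (_root_.logPartialSum N (u ξ) - _root_.logPartialSum N (v ξ)) ^ 2 = 0 :=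
    fun N => by simpa [sq] using (hS N).integral_mul_eq_zero (hS N)
  simp only [hzero] at hlim
  exact tendsto_nhds_unique hlim tendsto_const_nhds

/-- Causal transforms bounded by `q < 1` depend stably on the moduli `|1 + u|`. -/
theorem integral_norm_sub_sq_le (hu : IsCausalTransform u) (hv : IsCausalTransform v)
    {q : ℝ} (hq : q < 1) (huq : ∀ ξ, ‖u ξ‖ ≤ q) (hvq : ∀ ξ, ‖v ξ‖ ≤ q) :
    ∫ ξ, ‖u ξ - v ξ‖ ^ 2 ≤
      2 * ((1 + q) / (1 - q)) ^ 2 * ∫ ξ, (‖1 + u ξ‖ - ‖1 + v ξ‖) ^ 2 := by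
  set h : ℝ → ℂ := fun ξ => Complex.log (1 + u ξ) - Complex.log (1 + v ξ) with hh
  have hq0 : 0 ≤ q := (norm_nonneg _).trans (huq 0)
  have hmem : MemLp h 2 := (hu.memLp_log hq huq).sub (hv.memLp_log hq hvq)
  have hint : Integrable fun ξ => ‖h ξ‖ ^ 2 :=
    (memLp_two_iff_integrable_sq_norm hmem.1).1 hmem
  have hre : Integrable fun ξ => (h ξ).re ^ 2 := hmem.re.integrable_sq
  have hsq : Integrable fun ξ => h ξ ^ 2 := by
    refine hint.mono (hmem.1.pow 2) (Filter.Eventually.of_forall fun ξ => by simp)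
  have hzero : ∫ ξ, (h ξ ^ 2).re = 0 := by
    have := integral_re hsq
    simp only [RCLike.re_to_complex] at this
    rw [this, hu.integral_log_sub_log_sq_eq_zero hv hq huq hvq, Complex.zero_re]
  have hpyth : ∫ ξ, ‖h ξ‖ ^ 2 = 2 * ∫ ξ, (h ξ).re ^ 2 := by
    -- The term `Re (h²)` integrates to zero, which leaves twice the real part.
    have hpt : ∀ ξ, ‖h ξ‖ ^ 2 = 2 * (h ξ).re ^ 2 - (h ξ ^ 2).re := fun ξ => by
      rw [Complex.sq_norm, Complex.normSq_apply]
      simp only [sq, Complex.mul_re]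
      ring
    have hsqre : Integrable fun ξ => (h ξ ^ 2).re := hsq.re
    simp only [hpt]
    rw [integral_sub (hre.const_mul 2) hsqre, integral_const_mul, hzero, sub_zero]
  have hmod : Integrable fun ξ => (‖1 + u ξ‖ - ‖1 + v ξ‖) ^ 2 := by
    refine MemLp.integrable_sq ((hu.sub hv).memLp_two.mono ?_ (Filter.Eventually.of_forall ?_))
    · exact ((continuous_const.add hu.continuous).norm.sub
        (continuous_const.add hv.continuous).norm).aestronglyMeasurable
    · intro ξ
      simpa using abs_norm_sub_norm_le (1 + u ξ) (1 + v ξ)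
  calc ∫ ξ, ‖u ξ - v ξ‖ ^ 2 ≤ ∫ ξ, (1 + q) ^ 2 * ‖h ξ‖ ^ 2 := by
        refine integral_mono_of_nonneg (Filter.Eventually.of_forall fun ξ => by positivity)
          (hint.const_mul _) (Filter.Eventually.of_forall fun ξ => ?_)
        simp only [← mul_pow]
        gcongr
        exact norm_sub_le_mul_norm_log_sub_log hq (huq ξ) (hvq ξ)
    _ = (1 + q) ^ 2 * (2 * ∫ ξ, (h ξ).re ^ 2) := by rw [integral_const_mul, hpyth]
    _ ≤ (1 + q) ^ 2 * (2 * ∫ ξ, (‖1 + u ξ‖ - ‖1 + v ξ‖) ^ 2 / (1 - q) ^ 2) := by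
        gcongr ?_ * (?_ * ?_)
        refine integral_mono hre (hmod.div_const _) fun ξ => ?_
        simp only [← div_pow]
        rw [← sq_abs, ← sq_abs (_ / _), abs_div, abs_of_pos (show 0 < 1 - q by linarith)]
        gcongr
        exact abs_re_log_sub_log_le hq (huq ξ) (hvq ξ)
    _ = _ := by rw [integral_div, div_pow]; ring

end IsCausalTransform

/-! ### Application to `𝓑_{a,b}` and the metric of `L²_c` -/

theorem MeasureTheory.L2.norm_sq_eq_integral {α : Type*} [MeasurableSpace α] {μ : Measure α}
    (f : Lp ℂ 2 μ) : ‖f‖ ^ 2 = ∫ x, ‖f x‖ ^ 2 ∂μ := by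
  have h := inner_self_eq_norm_sq_to_K (𝕜 := ℂ) f
  rw [L2.inner_def] at h
  simp only [inner_self_eq_norm_sq_to_K] at h
  norm_cast at h
  exact h.symm

/-- An element of `𝓑_{a,b}` has a causal representative whose Fourier integral is bounded
by `a * b`. -/
theorem BoundedSupported.exists_isCausal {a b : ℝ} (ha : 0 < a) (hb : 0 < b) {f : L2R}
    (hf : f ∈ BoundedSupported a b) :
    ∃ g : ℝ → ℂ, IsCausal g ∧ f =ᵐ[volume] g ∧ ∀ ξ, ‖𝓕 g ξ‖ ≤ a * b := by
  obtain ⟨hfa, hfb⟩ := hf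
  -- Truncating turns the almost-everywhere bound and support condition into ones valid at every
  -- point.
  set s : Set ℝ := Icc 0 b ∩ {x | ‖f x‖ ≤ a} with hs
  have hsm : MeasurableSet s := measurableSet_Icc.inter
    (measurableSet_le (Lp.stronglyMeasurable f).measurable.norm measurable_const)
  have hle : ∀ x, ‖s.indicator f x‖ ≤ (Icc 0 b).indicator (fun _ => a) x := by
    intro x
    by_cases hx : x ∈ s
    · rw [indicator_of_mem hx, indicator_of_mem hx.1]
      exact hx.2
    · rw [indicator_of_notMem hx, norm_zero]
      exact indicator_nonneg (fun _ _ => ha.le) x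
  have hdom : Integrable ((Icc 0 b).indicator fun _ => a) :=
    (integrable_indicator_iff measurableSet_Icc).2 (integrableOn_const (by simp))
  have hint : Integrable (s.indicator f) :=
    hdom.mono' ((Lp.stronglyMeasurable f).indicator hsm).aestronglyMeasurable
      (Filter.Eventually.of_forall hle)
  refine ⟨s.indicator f, ⟨hint, ⟨a, fun x => (hle x).trans ?_⟩, fun x hx => ?_⟩, ?_, fun ξ => ?_⟩
  · exact indicator_le_self' (fun _ _ => ha.le) x
  · exact indicator_of_notMem (fun h => absurd h.1.1 (not_le.2 hx)) _
  · have hbd : ∀ᵐ x, ‖f x‖ₑ ≤ ENNReal.ofReal a := by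
      filter_upwards [ae_le_eLpNormEssSup (f := f) (μ := volume)] with x hx
      exact hx.trans (by simpa using hfa.le)
    filter_upwards [hbd, hfb] with x hx hxb
    by_cases hxI : x ∈ Icc 0 b
    · rw [indicator_of_mem]
      refine ⟨hxI, ?_⟩
      rwa [← ofReal_norm, ENNReal.ofReal_le_ofReal_iff ha.le] at hx
    · rw [indicator_of_notMem (fun h => hxI h.1), hxb hxI]
  · calc ‖𝓕 (s.indicator f) ξ‖ ≤ ∫ x, ‖s.indicator f x‖ :=
          VectorFourier.norm_fourierIntegral_le_integral_norm _ _ _ _ _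
      _ ≤ ∫ x, (Icc 0 b).indicator (fun _ => a) x := integral_mono hint.norm hdom hle
      _ = a * b := by
          rw [integral_indicator_const _ measurableSet_Icc]
          simp [hb.le, mul_comm]

/-- For `f ∈ 𝓑_{a,b}`, the Fourier transform is `c` times a causal transform bounded
by `a * b / c`. -/
theorem BoundedSupported.exists_isCausalTransform {a b c : ℝ} (ha : 0 < a) (hb : 0 < b)
    (hc : 0 < c) {f : L2R} (hf : f ∈ BoundedSupported a b) :
    ∃ u : ℝ → ℂ, IsCausalTransform u ∧ (∀ ξ, ‖u ξ‖ ≤ a * b / c) ∧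
      (𝓕 f : L2R) =ᵐ[volume] fun ξ => c * u ξ := by
  obtain ⟨g, hg, hfg, hbd⟩ := exists_isCausal ha hb hf
  refine ⟨(c⁻¹ : ℂ) • 𝓕 g, IsCausalTransform.const_smul ⟨g, hg, rfl⟩ _, fun ξ => ?_, ?_⟩
  · rw [Pi.smul_apply, norm_smul, norm_inv, Complex.norm_real, Real.norm_of_nonneg hc.le,
      inv_mul_eq_div]
    gcongr
    exact hbd ξ
  · filter_upwards [Lp.fourier_ae_eq_of_integrable hfg hg.integrable] with ξ hξ
    have hc' : (c : ℂ) ≠ 0 := by exact_mod_cast hc.ne'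
    rw [hξ, Pi.smul_apply, smul_eq_mul, mul_inv_cancel_left₀ hc']

theorem coeFn_shiftedMagnitude (c : ℝ) (f : L2R) :
    shiftedMagnitude c f =ᵐ[volume] fun ξ => ((‖(𝓕 f : L2R) ξ + c‖ : ℝ) : ℂ) := by
  filter_upwards [AEEqFun.coeFn_comp (fun z : ℂ => ((‖z‖ : ℝ) : ℂ))
      (Complex.continuous_ofReal.comp continuous_norm)
      (((𝓕 f : L2R) : ℝ →ₘ[(volume : Measure ℝ)] ℂ) + AEEqFun.const ℝ (c : ℂ)),
    AEEqFun.coeFn_add ((𝓕 f : L2R) : ℝ →ₘ[(volume : Measure ℝ)] ℂ) (AEEqFun.const ℝ (c : ℂ)),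
    AEEqFun.coeFn_const (μ := (volume : Measure ℝ)) ℝ (c : ℂ)] with ξ h1 h2 h3
  rw [shiftedMagnitude, h1, Function.comp_apply, h2, Pi.add_apply, h3]
  rfl

/-- Reverse triangle inequality: `||f̂ + c| - c| ≤ |f̂|`, using `|c| = c`. -/
theorem shiftedMagnitude_mem_L2Shift {c : ℝ} (hc : 0 ≤ c) (f : L2R) :
    shiftedMagnitude c f ∈ L2Shift c := by
  have hmem : shiftedMagnitude c f - AEEqFun.const ℝ (c : ℂ) ∈ Lp ℂ 2 (volume : Measure ℝ) := by
    refine Lp.mem_Lp_of_ae_le (g := (𝓕 f : L2R)) ?_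
    filter_upwards [AEEqFun.coeFn_sub (shiftedMagnitude c f) (AEEqFun.const ℝ (c : ℂ)),
      coeFn_shiftedMagnitude c f, AEEqFun.coeFn_const (μ := (volume : Measure ℝ)) ℝ (c : ℂ)]
      with ξ h1 h2 h3
    rw [h1, Pi.sub_apply, h2, h3, Function.const_apply, ← Complex.ofReal_sub, Complex.norm_real]
    simpa [abs_of_nonneg hc] using abs_norm_sub_norm_le ((𝓕 f : L2R) ξ + c) (c : ℂ)
  exact ⟨⟨_, hmem⟩, (sub_add_cancel _ _).symm⟩

theorem L2Shift.dist_sq_eq_integral {c : ℝ} (g h : L2Shift c) :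
    dist g h ^ 2 = ∫ ξ, ‖g.1 ξ - h.1 ξ‖ ^ 2 := by
  refine (L2.norm_sq_eq_integral (⟨g.1 - h.1, L2Shift.sub_mem g h⟩ : L2R)).trans ?_
  refine integral_congr_ae ?_
  filter_upwards [AEEqFun.coeFn_sub g.1 h.1] with ξ hξ
  rw [hξ, Pi.sub_apply]

theorem norm_sub_le_mul_dist_shiftedMagnitude {a b c : ℝ} (ha : 0 < a) (hb : 0 < b)
    (hc : a * b < c) {f₁ f₂ : L2R} (hf₁ : f₁ ∈ BoundedSupported a b)
    (hf₂ : f₂ ∈ BoundedSupported a b) (g₁ g₂ : L2Shift c) (hg₁ : g₁.1 = shiftedMagnitude c f₁)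
    (hg₂ : g₂.1 = shiftedMagnitude c f₂) :
    ‖f₁ - f₂‖ ≤ √2 * ((c + a * b) / (c - a * b)) * dist g₁ g₂ := by
  have hab : 0 < a * b := mul_pos ha hb
  have hc0 : 0 < c := hab.trans hc
  have hsub : 0 < c - a * b := sub_pos.2 hc
  obtain ⟨u, hu, huq, hfu⟩ := BoundedSupported.exists_isCausalTransform ha hb hc0 hf₁
  obtain ⟨v, hv, hvq, hfv⟩ := BoundedSupported.exists_isCausalTransform ha hb hc0 hf₂
  have hfsub : (𝓕 (f₁ - f₂) : L2R) = 𝓕 f₁ - 𝓕 f₂ := (Lp.fourierTransformₗᵢ ℝ ℂ).map_sub f₁ f₂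
  have hnorm : ‖f₁ - f₂‖ ^ 2 = c ^ 2 * ∫ ξ, ‖u ξ - v ξ‖ ^ 2 := by
    rw [← Lp.norm_fourier_eq, hfsub, L2.norm_sq_eq_integral,
      ← integral_const_mul]
    refine integral_congr_ae ?_
    filter_upwards [Lp.coeFn_sub (𝓕 f₁ : L2R) (𝓕 f₂), hfu, hfv] with ξ h h1 h2
    rw [h, Pi.sub_apply, h1, h2, ← mul_sub, norm_mul, mul_pow, Complex.norm_real,
      Real.norm_of_nonneg hc0.le]
  have hdist : dist g₁ g₂ ^ 2 = c ^ 2 * ∫ ξ, (‖1 + u ξ‖ - ‖1 + v ξ‖) ^ 2 := by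
    rw [L2Shift.dist_sq_eq_integral, hg₁, hg₂, ← integral_const_mul]
    refine integral_congr_ae ?_
    have hfac : ∀ z : ℂ, ‖(c : ℂ) * z + c‖ = c * ‖1 + z‖ := fun z => by
      rw [add_comm, ← mul_one_add, norm_mul, Complex.norm_real, Real.norm_of_nonneg hc0.le]
    filter_upwards [coeFn_shiftedMagnitude c f₁, coeFn_shiftedMagnitude c f₂, hfu, hfv]
      with ξ h1 h2 h3 h4
    rw [h1, h2, h3, h4, hfac, hfac, ← Complex.ofReal_sub, Complex.norm_real, Real.norm_eq_abs,
      sq_abs]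
    ring
  have hratio : (1 + a * b / c) / (1 - a * b / c) = (c + a * b) / (c - a * b) := by
    have : c - a * b ≠ 0 := hsub.ne'
    field_simp
  -- Here `q = ab/c`, which is below 1 exactly because `ab < c`.
  have key := hu.integral_norm_sub_sq_le hv ((div_lt_one hc0).2 hc) huq hvq
  rw [hratio] at key
  refine le_of_sq_le_sq ?_ (by positivity)
  rw [mul_pow, mul_pow, Real.sq_sqrt zero_le_two, hnorm, hdist]
  calc _ ≤ c ^ 2 * _ := mul_le_mul_of_nonneg_left key (sq_nonneg c)
    _ = _ := by ring

theorem mainTheorem11 (a b c : ℝ) (ha : 0 < a) (hb : 0 < b) (hc : a * b < c) :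
    ∃ hmaps : MapsTo (shiftedMagnitude c) (BoundedSupported a b) (L2Shift c),
    ∃ hinj : Function.Injective
        (hmaps.restrict (shiftedMagnitude c) (BoundedSupported a b) (L2Shift c)),
      UniformContinuous (Equiv.ofInjective _ hinj).symm ∧
      ∃ C : ℝ, 0 < C ∧ ∀ f₁ f₂ : BoundedSupported a b,
        ‖(f₁ : L2R) - (f₂ : L2R)‖ ≤
          C * dist (hmaps.restrict (shiftedMagnitude c) (BoundedSupported a b) (L2Shift c) f₁)
            (hmaps.restrict (shiftedMagnitude c) (BoundedSupported a b) (L2Shift c) f₂) := by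

  have hc0 : 0 < c := (mul_pos ha hb).trans hc
  have hmaps : MapsTo (shiftedMagnitude c) (BoundedSupported a b) (L2Shift c) :=
    fun f _ => shiftedMagnitude_mem_L2Shift hc0.le f
  set C : ℝ := √2 * ((c + a * b) / (c - a * b)) with hC
  have hCpos : 0 < C := by
    have h1 := mul_pos ha hb
    have h2 := sub_pos.2 hc
    positivity
  have hbound : ∀ f₁ f₂ : BoundedSupported a b, ‖(f₁ : L2R) - (f₂ : L2R)‖ ≤
      C * dist (hmaps.restrict (shiftedMagnitude c) (BoundedSupported a b) (L2Shift c) f₁)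
        (hmaps.restrict (shiftedMagnitude c) (BoundedSupported a b) (L2Shift c) f₂) :=
    fun f₁ f₂ => norm_sub_le_mul_dist_shiftedMagnitude ha hb hc f₁.2 f₂.2 _ _ rfl rfl
  have hinj : Function.Injective
      (hmaps.restrict (shiftedMagnitude c) (BoundedSupported a b) (L2Shift c)) := by
    intro f₁ f₂ h
    have := hbound f₁ f₂
    rw [h, dist_self, mul_zero] at this
    exact Subtype.ext (sub_eq_zero.1 (norm_le_zero_iff.1 this))
  refine ⟨hmaps, hinj, ?_, C, hCpos, hbound⟩
  refine (LipschitzWith.of_dist_le_mul (K := ⟨C, hCpos.le⟩) fun y₁ y₂ => ?_).uniformContinuous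
  obtain ⟨f₁, rfl⟩ := (Equiv.ofInjective _ hinj).surjective y₁
  obtain ⟨f₂, rfl⟩ := (Equiv.ofInjective _ hinj).surjective y₂
  rw [Equiv.symm_apply_apply, Equiv.symm_apply_apply, Subtype.dist_eq, dist_eq_norm]
  exact hbound f₁ f₂
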